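/- Let $f:\mathbb{R}\to\mathbb{R}$ be a real analytic function. Let $(x,y,\tilde x,\tilde y)$ be the standard coordinates on $\mathbb{R}^4$, and let $\mathcal{M}_f:=(\mathbb{R}^4,g_f)$, where $g_f$ is the pseudo-Riemannian metric of signature $(2,2)$ whose non-zero components, up to the symmetry of $g_f$, are $$g_f(\partial_x,\partial_x)=-2f(y),\qquad g_f(\partial_x,\partial_{\tilde x})=g_f(\partial_y,\partial_{\tilde y})=1 .$$ Then: 1. $\mathcal{M}_f$ is symmetric if and only if $f'''\equiv 0$. This holds for both meanings of "symmetric": $\mathcal{M}_f$ is locally symmetric (that is, $\nabla R=0$, where $R$ is the curvature tensor and $\nabla$ the Levi-Civita connection) if and only if $f'''\equiv0$; and $\mathcal{M}_f$ is a globally symmetric space (that is, for every point $P$ there is an isometry of $\mathcal{M}_f$ that fixes $P$ and has differential $-\mathrm{Id}$ at $P$) if and only if $f'''\equiv0$. 2. $\mathcal{M}_f$ is (globally) homogeneous, that is, its isometry group (the group of all smooth diffeomorphisms $\phi$ of $\mathbb{R}^4$ with $\phi^*g_f=g_f$) acts transitively on $\mathbb{R}^4$, if and only if there are $a,\lambda\in\mathbb{R}$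 with $f''(y)=ae^{\lambda y}$ for all $y\in\mathbb{R}$. -/

import Mathlib

open scoped ContDiff

noncomputable section

/-- The partial derivative `∂F/∂xᵢ` of a real function on `ℝⁿ` at the point `p`. -/
def partialD {n : ℕ} (i : Fin n) (F : (Fin n → ℝ) → ℝ) (p : Fin n → ℝ) : ℝ :=
  fderiv ℝ F p (Pi.single i 1)

/-- A smooth pseudo-Riemannian metric on the manifold `ℝⁿ`, given by its components
`g p i j = g(∂ᵢ, ∂ⱼ)` at `p` in the standard global coordinates. (The sup norm that `Fin n → ℝ`
carries in Mathlib matters only through its topology.) -/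
structure PseudoRiemannianMetric (n : ℕ) where
  g : (Fin n → ℝ) → Matrix (Fin n) (Fin n) ℝ
  smooth : ∀ i j, ContDiff ℝ ∞ (fun p => g p i j)
  symm : ∀ p i j, g p i j = g p j i
  nondegenerate : ∀ p, (g p).det ≠ 0

namespace PseudoRiemannianMetric

variable {n : ℕ} (M : PseudoRiemannianMetric n)

/-- The inner product `g_p(u, v)` of two tangent vectors at `p`. -/
def inner (p u v : Fin n → ℝ) : ℝ := ∑ i, ∑ j, M.g p i j * u i * v j

/-- The Christoffel symbols of the Levi-Civita connection:
`∇_{∂ᵢ} ∂ⱼ = ∑ₖ (christoffel i j k) ∂ₖ`. -/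
def christoffel (i j k : Fin n) (p : Fin n → ℝ) : ℝ :=
  (1 / 2) * ∑ l, (M.g p)⁻¹ k l *
    (partialD i (fun q => M.g q j l) p + partialD j (fun q => M.g q i l) p
      - partialD l (fun q => M.g q i j) p)

/-- The components of the curvature operator `R(X, Y) = ∇_X ∇_Y - ∇_Y ∇_X - ∇_{[X, Y]}`:
`R(∂ᵢ, ∂ⱼ) ∂ₖ = ∑ₗ (curvatureOp i j k l) ∂ₗ`. -/
def curvatureOp (i j k l : Fin n) (p : Fin n → ℝ) : ℝ :=
  partialD i (M.christoffel j k l) p - partialD j (M.christoffel i k l) p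
    + ∑ m, (M.christoffel j k m p * M.christoffel i m l p
      - M.christoffel i k m p * M.christoffel j m l p)

/-- The curvature tensor `R(∂ᵢ, ∂ⱼ, ∂ₖ, ∂ₗ) = g(R(∂ᵢ, ∂ⱼ) ∂ₖ, ∂ₗ)`. -/
def curvature (i j k l : Fin n) (p : Fin n → ℝ) : ℝ :=
  ∑ m, M.curvatureOp i j k m p * M.g p m l

/-- The covariant derivative of the curvature tensor: the component
`∇R(∂ᵢ, ∂ⱼ, ∂ₖ, ∂ₗ; ∂ₘ) = (∇_{∂ₘ} R)(∂ᵢ, ∂ⱼ, ∂ₖ, ∂ₗ)`. -/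
def nablaCurvature (i j k l m : Fin n) (p : Fin n → ℝ) : ℝ :=
  partialD m (M.curvature i j k l) p
    - ∑ a, (M.christoffel m i a p * M.curvature a j k l p
      + M.christoffel m j a p * M.curvature i a k l p
      + M.christoffel m k a p * M.curvature i j a l p
      + M.christoffel m l a p * M.curvature i j k a p)

/-- The manifold is locally symmetric: `∇R = 0`. -/
def IsLocallySymmetric : Prop :=
  ∀ i j k l m p, M.nablaCurvature i j k l m p = 0

/-- The isometry group: the smooth diffeomorphisms `φ` of `ℝⁿ` with `φ^* g = g`. -/
def isometryGroup : Subgroup (Equiv.Perm (Fin n → ℝ)) where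
  carrier := {φ | ContDiff ℝ ∞ φ ∧ ContDiff ℝ ∞ φ.symm ∧
    ∀ p u v, M.inner (φ p) (fderiv ℝ φ p u) (fderiv ℝ φ p v) = M.inner p u v}
  one_mem' := by
    refine ⟨contDiff_id, contDiff_id, fun p u v => ?_⟩
    simp
  mul_mem' := by
    rintro φ ψ ⟨h1, h2, h3⟩ ⟨k1, k2, k3⟩
    refine ⟨h1.comp k1, k2.comp h2, fun p u v => ?_⟩
    have h : fderiv ℝ (⇑(φ * ψ)) p = (fderiv ℝ φ (ψ p)).comp (fderiv ℝ ψ p) :=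
      fderiv_comp p (h1.differentiable (by simp) _) (k1.differentiable (by simp) _)
    rw [h]
    exact (h3 _ _ _).trans (k3 _ _ _)
  inv_mem' := by
    rintro φ ⟨h1, h2, h3⟩
    refine ⟨h2, h1, fun p u v => ?_⟩
    have h : (fderiv ℝ φ (φ.symm p)).comp (fderiv ℝ φ.symm p) = ContinuousLinearMap.id ℝ _ := by
      rw [← fderiv_comp p (h1.differentiable (by simp) _) (h2.differentiable (by simp) _)]
      have : ⇑φ ∘ ⇑φ.symm = id := by ext x : 1; simp
      rw [this, fderiv_id]
    have hu : ∀ w, fderiv ℝ φ (φ.symm p) (fderiv ℝ φ.symm p w) = w := fun w =>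
      congrArg (fun L => L w) h
    have := h3 (φ.symm p) (fderiv ℝ φ.symm p u) (fderiv ℝ φ.symm p v)
    rw [hu, hu, Equiv.apply_symm_apply] at this
    exact this.symm

/-- The manifold is a (globally) symmetric space: every point `P` is fixed by an isometry
whose differential at `P` is `-Id`. -/
def IsSymmetricSpace : Prop :=
  ∀ P, ∃ φ ∈ M.isometryGroup, φ P = P ∧ ∀ u, fderiv ℝ φ P u = -u

/-- The manifold is homogeneous: its isometry group acts transitively. -/
def IsHomogeneous : Prop :=
  ∀ P Q, ∃ φ ∈ M.isometryGroup, φ P = Q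

end PseudoRiemannianMetric

/-- The generalized plane wave manifold `M_f = (ℝ⁴, g_f)`. The coordinates `0, 1, 2, 3` are
`x, y, x̃, ỹ`; the non-zero components are `g(∂ₓ, ∂ₓ) = -2 f(y)`, `g(∂ₓ, ∂_x̃) = g(∂_y, ∂_ỹ) = 1`
and those given by symmetry. -/
def planeWave (f : ℝ → ℝ) (hf : AnalyticOnNhd ℝ f Set.univ) : PseudoRiemannianMetric 4 where
  g p := !![-2 * f (p 1), 0, 1, 0;
            0, 0, 0, 1;
            1, 0, 0, 0;
            0, 1, 0, 0]
  smooth := by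
    have h : ContDiff ℝ ∞ f := hf.contDiff
    intro i j
    fin_cases i <;> fin_cases j <;> simp <;> fun_prop
  symm := by
    intro p i j
    fin_cases i <;> fin_cases j <;> simp
  nondegenerate := by
    intro p
    simp [Matrix.det_succ_row_zero, Fin.sum_univ_succ, Fin.succAbove]

end

/-! The only nonzero Christoffel symbols are `Γ₀₀³ = f'` and `Γ₀₁² = Γ₁₀² = -f'`. Up to its
symmetries, the curvature has the single component `R(∂ₓ, ∂_y, ∂_y, ∂ₓ) = f''`, and `∇R` the single
component `f'''`, in the direction `∂_y`. This settles local symmetry.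

Isometries are built explicitly: if `α² f(σ(y - P₁) + Q₁) - f(y)` is affine in `y` and `σ² = 1`, a
polynomial map sending `P` to `Q` absorbs the affine term into `x̃` and `ỹ`
(`waveEquiv_mem_isometryGroup`). When `f'' = a e^{λy}`, take `σ = 1` and a suitable `α`; when `f'' `
is constant, `α = σ = -1` gives the point reflections.

Conversely, `dx` and `dy` are parallel, so an isometry pulls them back to parallel forms. If `f''`
is not identically zero, such forms are constant combinations of `dx` and `dy`
(`partialD_eq_of_parallel`). The isometry thus acts affinely on `(x, y)`, and invariance of
curvature yields `f''(Y) · det² = f''(y)` (`rigidity`). A reflection then forces `f''(y) = f''(0)`.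
Transitivity forces `f''` to reproduce itself under affine rescalings with arbitrary translation
part, which makes it exponential (`exists_eq_mul_exp_of_rescaling`). -/

/-! ### Partial derivatives and affine functions -/

section Calculus

variable {n : ℕ}

theorem partialD_add {F G : (Fin n → ℝ) → ℝ} (hF : Differentiable ℝ F) (hG : Differentiable ℝ G)
    (i : Fin n) (p : Fin n → ℝ) :
    partialD i (fun q => F q + G q) p = partialD i F p + partialD i G p := by
  simp [partialD, fderiv_fun_add (hF p) (hG p)]

theorem partialD_sub {F G : (Fin n → ℝ) → ℝ} (hF : Differentiable ℝ F) (hG : Differentiable ℝ G)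
    (i : Fin n) (p : Fin n → ℝ) :
    partialD i (fun q => F q - G q) p = partialD i F p - partialD i G p := by
  simp [partialD, fderiv_fun_sub (hF p) (hG p)]

theorem partialD_mul {F G : (Fin n → ℝ) → ℝ} (hF : Differentiable ℝ F) (hG : Differentiable ℝ G)
    (i : Fin n) (p : Fin n → ℝ) :
    partialD i (fun q => F q * G q) p = F p * partialD i G p + partialD i F p * G p := by
  simp [partialD, fderiv_fun_mul (hF p) (hG p), mul_comm]

theorem partialD_const_mul {F : (Fin n → ℝ) → ℝ} (c : ℝ) (hF : Differentiable ℝ F)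
    (i : Fin n) (p : Fin n → ℝ) :
    partialD i (fun q => c * F q) p = c * partialD i F p := by
  simp [partialD, fderiv_const_mul (hF p)]

@[simp]
theorem partialD_const (c : ℝ) (i : Fin n) (p : Fin n → ℝ) : partialD i (fun _ => c) p = 0 := by
  simp [partialD]

theorem partialD_comp {h : ℝ → ℝ} {F : (Fin n → ℝ) → ℝ} (hh : Differentiable ℝ h)
    (hF : Differentiable ℝ F) (i : Fin n) (p : Fin n → ℝ) :
    partialD i (fun q => h (F q)) p = deriv h (F p) * partialD i F p := by
  have := ((hh (F p)).hasDerivAt.comp_hasFDerivAt p (hF p).hasFDerivAt).fderiv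
  simp only [Function.comp_def] at this
  simp [partialD, this]

theorem partialD_coord (i j : Fin n) (p : Fin n → ℝ) :
    partialD i (fun q => q j) p = if i = j then 1 else 0 := by
  have : fderiv ℝ (fun q : Fin n → ℝ => q j) p = ContinuousLinearMap.proj j :=
    (ContinuousLinearMap.proj (R := ℝ) (φ := fun _ : Fin n => ℝ) j).fderiv
  simp [partialD, this, Pi.single_apply, eq_comm]

theorem partialD_comp_coord {h : ℝ → ℝ} (hh : Differentiable ℝ h) (i j : Fin n)
    (p : Fin n → ℝ) :
    partialD i (fun q => h (q j)) p = if i = j then deriv h (p j) else 0 := by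
  rw [partialD_comp hh (by fun_prop), partialD_coord]
  simp

theorem contDiff_partialD {F : (Fin n → ℝ) → ℝ} (hF : ContDiff ℝ ∞ F) (i : Fin n) :
    ContDiff ℝ ∞ (partialD i F) :=
  (hF.fderiv_right (m := ∞) (by simp)).clm_apply contDiff_const

theorem partialD_comm {F : (Fin n → ℝ) → ℝ} (hF : ContDiff ℝ ∞ F) (i j : Fin n)
    (p : Fin n → ℝ) : partialD i (partialD j F) p = partialD j (partialD i F) p := by
  have hd : DifferentiableAt ℝ (fderiv ℝ F) p :=
    (hF.fderiv_right (m := ∞) (by simp)).differentiable (by simp) p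
  have h : ∀ i j : Fin n, partialD i (partialD j F) p
      = fderiv ℝ (fderiv ℝ F) p (Pi.single i 1) (Pi.single j 1) := by
    intro i j
    change fderiv ℝ (fun q => fderiv ℝ F q (Pi.single j 1)) p (Pi.single i 1) = _
    rw [fderiv_clm_apply hd (by fun_prop)]
    simp
  rw [h, h]
  exact ((contDiff_infty.1 hF 2).contDiffAt.isSymmSndFDerivAt (by simp)) _ _

theorem fderiv_apply_eq_sum_partialD (F : (Fin n → ℝ) → ℝ) (p v : Fin n → ℝ) :
    fderiv ℝ F p v = ∑ i, v i * partialD i F p := by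
  conv_lhs => rw [pi_eq_sum_univ' v]
  simp [partialD, map_sum]

theorem eq_const_of_partialD_eq_zero {F : (Fin n → ℝ) → ℝ} (hF : Differentiable ℝ F)
    (h : ∀ i p, partialD i F p = 0) (p q : Fin n → ℝ) : F p = F q := by
  refine is_const_of_fderiv_eq_zero hF (fun x => ?_) p q
  ext v
  simp [fderiv_apply_eq_sum_partialD, h]

theorem eq_affine_of_partialD_partialD_eq_zero {F : (Fin n → ℝ) → ℝ} (hF : ContDiff ℝ ∞ F)
    (h : ∀ i j p, partialD i (partialD j F) p = 0) (p₀ p : Fin n → ℝ) :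
    F p = F p₀ + ∑ i, partialD i F p₀ * (p i - p₀ i) := by
  have hd : Differentiable ℝ F := hF.differentiable (by simp)
  have hc : ∀ j q, partialD j F q = partialD j F p₀ := fun j q =>
    eq_const_of_partialD_eq_zero ((contDiff_partialD hF j).differentiable (by simp))
      (fun i p => h i j p) q p₀
  have hL : Differentiable ℝ (fun q : Fin n → ℝ => ∑ i, partialD i F p₀ * (q i - p₀ i)) := by
    fun_prop
  have := eq_const_of_partialD_eq_zero (hd.sub hL) (fun j q => ?_) p p₀
  · simp at this
    linarith
  · change partialD j (fun q => F q - ∑ i, partialD i F p₀ * (q i - p₀ i)) q = 0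
    rw [partialD_sub hd hL, hc j q, sub_eq_zero]
    have : HasFDerivAt (fun q : Fin n → ℝ => ∑ i, partialD i F p₀ * (q i - p₀ i))
        (∑ i, partialD i F p₀ • ContinuousLinearMap.proj (R := ℝ) (φ := fun _ : Fin n => ℝ) i) q :=
      HasFDerivAt.fun_sum fun i _ => (((ContinuousLinearMap.proj (R := ℝ)
        (φ := fun _ : Fin n => ℝ) i).hasFDerivAt).sub_const _).const_mul _
    change _ = fderiv ℝ _ q _
    rw [this.fderiv]
    simp [Pi.single_apply]

theorem contDiff_deriv {h : ℝ → ℝ} (hh : ContDiff ℝ ∞ h) : ContDiff ℝ ∞ (deriv h) := by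
  have h' : ContDiff ℝ (∞ + 1) h := hh
  exact (contDiff_succ_iff_deriv.mp h').2.2

theorem eq_affine_of_deriv_deriv_eq_zero {h : ℝ → ℝ} (hh : ContDiff ℝ ∞ h)
    (h2 : ∀ y, deriv (deriv h) y = 0) (y₀ y : ℝ) : h y = h y₀ + deriv h y₀ * (y - y₀) := by
  have hd : Differentiable ℝ (deriv h) := (contDiff_deriv hh).differentiable (by simp)
  have h0 : Differentiable ℝ h := hh.differentiable (by simp)
  have hc : ∀ z, deriv h z = deriv h y₀ := fun z => is_const_of_deriv_eq_zero hd h2 z y₀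
  have := is_const_of_deriv_eq_zero (f := fun z => h z - deriv h y₀ * (z - y₀))
    (by fun_prop) (fun z => ?_) y y₀
  · simp at this
    linarith
  · have hz : HasDerivAt (fun z => h z - deriv h y₀ * (z - y₀)) (deriv h z - deriv h y₀ * 1) z :=
      (h0 z).hasDerivAt.sub (((hasDerivAt_id z).sub_const _).const_mul _)
    rw [hz.deriv, hc z]
    ring

end Calculus

/-! ### Connection, curvature and local symmetry of the plane wave -/

section Curvature

theorem planeWave_inv (f : ℝ → ℝ) (hf : AnalyticOnNhd ℝ f Set.univ) (p : Fin 4 → ℝ) :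
    ((planeWave f hf).g p)⁻¹ = !![0, 0, 1, 0; 0, 0, 0, 1; 1, 0, 2 * f (p 1), 0; 0, 1, 0, 0] := by
  apply Matrix.inv_eq_right_inv
  ext i j
  fin_cases i <;> fin_cases j <;>
    simp [planeWave, Matrix.mul_apply, Fin.sum_univ_four]

theorem planeWave_g_apply (f : ℝ → ℝ) (hf : AnalyticOnNhd ℝ f Set.univ) (p : Fin 4 → ℝ)
    (i j : Fin 4) :
    (planeWave f hf).g p i j = (if i = 0 ∧ j = 0 then -2 else 0) * f (p 1) +
      if (i = 0 ∧ j = 2) ∨ (i = 2 ∧ j = 0) ∨ (i = 1 ∧ j = 3) ∨ (i = 3 ∧ j = 1) then 1 else 0 := by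
  fin_cases i <;> fin_cases j <;> simp [planeWave]

theorem planeWave_partialD_g (f : ℝ → ℝ) (hf : AnalyticOnNhd ℝ f Set.univ) (p : Fin 4 → ℝ)
    (i j l : Fin 4) :
    partialD l (fun q => (planeWave f hf).g q i j) p =
      if i = 0 ∧ j = 0 ∧ l = 1 then -2 * deriv f (p 1) else 0 := by
  have hd : Differentiable ℝ f := hf.contDiff.differentiable (n := ∞) (by simp)
  simp only [planeWave_g_apply]
  rw [partialD_add (by fun_prop) (by fun_prop), partialD_const_mul _ (by fun_prop),
    partialD_comp_coord hd, partialD_const]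
  split_ifs <;> simp_all

/-- The constant coefficients of the Christoffel symbols of a plane wave: they equal
`waveGamma i j k * f' (y)`. -/
def waveGamma (i j k : Fin 4) : ℝ :=
  (if i = 0 ∧ j = 0 ∧ k = 3 then 1 else 0) -
    if ((i = 0 ∧ j = 1) ∨ (i = 1 ∧ j = 0)) ∧ k = 2 then 1 else 0

theorem planeWave_christoffel (f : ℝ → ℝ) (hf : AnalyticOnNhd ℝ f Set.univ) (i j k : Fin 4) :
    (planeWave f hf).christoffel i j k = fun p => waveGamma i j k * deriv f (p 1) := by
  funext p
  simp only [PseudoRiemannianMetric.christoffel, planeWave_inv, planeWave_partialD_g, waveGamma,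
    Fin.sum_univ_four]
  fin_cases i <;> fin_cases j <;> fin_cases k <;> simp

/-- The constant coefficients of the curvature of a plane wave: it equals
`waveCurvature i j k l * f'' (y)`. -/
def waveCurvature (i j k l : Fin 4) : ℝ :=
  ((if i = 0 ∧ j = 1 then 1 else 0) - if i = 1 ∧ j = 0 then 1 else 0) *
    ((if k = 1 ∧ l = 0 then 1 else 0) - if k = 0 ∧ l = 1 then 1 else 0)

theorem planeWave_curvatureOp (f : ℝ → ℝ) (hf : AnalyticOnNhd ℝ f Set.univ) (i j k l : Fin 4)
    (p : Fin 4 → ℝ) :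
    (planeWave f hf).curvatureOp i j k l p =
      ((if i = 1 then waveGamma j k l else 0) - if j = 1 then waveGamma i k l else 0) *
        deriv (deriv f) (p 1) := by
  have hd : Differentiable ℝ (deriv f) :=
    (contDiff_deriv hf.contDiff).differentiable (by simp)
  -- The upper index of a nonzero Christoffel symbol is `2` or `3`, its lower indices are `0` or
  -- `1`; hence all products `ΓΓ` contracted over `m` vanish.
  have hz : ∀ i j k l m : Fin 4, waveGamma j k m * waveGamma i m l = 0 := by
    intro i j k l m
    fin_cases m <;> simp [waveGamma]
  have hs : ∀ m, waveGamma j k m * deriv f (p 1) * (waveGamma i m l * deriv f (p 1))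
      - waveGamma i k m * deriv f (p 1) * (waveGamma j m l * deriv f (p 1)) = 0 := by
    intro m
    linear_combination deriv f (p 1) ^ 2 * hz i j k l m - deriv f (p 1) ^ 2 * hz j i k l m
  simp only [PseudoRiemannianMetric.curvatureOp, planeWave_christoffel, hs]
  rw [partialD_const_mul _ (by fun_prop), partialD_const_mul _ (by fun_prop),
    partialD_comp_coord hd, partialD_comp_coord hd]
  simp only [Finset.sum_const_zero]
  split_ifs <;> ring

theorem planeWave_curvature (f : ℝ → ℝ) (hf : AnalyticOnNhd ℝ f Set.univ) (i j k l : Fin 4) :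
    (planeWave f hf).curvature i j k l =
      fun p => waveCurvature i j k l * deriv (deriv f) (p 1) := by
  funext p
  simp only [PseudoRiemannianMetric.curvature, planeWave_curvatureOp, Fin.sum_univ_four,
    planeWave_g_apply]
  fin_cases k <;> fin_cases l <;> simp [waveGamma, waveCurvature] <;>
    fin_cases i <;> fin_cases j <;> simp

theorem planeWave_nablaCurvature (f : ℝ → ℝ) (hf : AnalyticOnNhd ℝ f Set.univ)
    (i j k l m : Fin 4) (p : Fin 4 → ℝ) :
    (planeWave f hf).nablaCurvature i j k l m p =
      if m = 1 then waveCurvature i j k l * deriv (deriv (deriv f)) (p 1) else 0 := by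
  have hd : Differentiable ℝ (deriv (deriv f)) :=
    (contDiff_deriv (contDiff_deriv hf.contDiff)).differentiable (by simp)
  -- Likewise the curvature lives on the indices `0`, `1`, so contracting it with an upper index of
  -- `Γ` gives zero and only the plain derivative survives.
  have h1 : ∀ a, waveGamma m i a * waveCurvature a j k l = 0 := by
    intro a; fin_cases a <;> simp [waveGamma, waveCurvature]
  have h2 : ∀ a, waveGamma m j a * waveCurvature i a k l = 0 := by
    intro a; fin_cases a <;> simp [waveGamma, waveCurvature]
  have h3 : ∀ a, waveGamma m k a * waveCurvature i j a l = 0 := by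
    intro a; fin_cases a <;> simp [waveGamma, waveCurvature]
  have h4 : ∀ a, waveGamma m l a * waveCurvature i j k a = 0 := by
    intro a; fin_cases a <;> simp [waveGamma, waveCurvature]
  simp only [PseudoRiemannianMetric.nablaCurvature, planeWave_christoffel, planeWave_curvature]
  rw [partialD_const_mul _ (by fun_prop), partialD_comp_coord hd, Finset.sum_eq_zero]
  · split_ifs <;> simp
  · intro a _
    linear_combination (deriv f (p 1) * deriv (deriv f) (p 1)) * (h1 a + h2 a + h3 a + h4 a)

theorem planeWave_isLocallySymmetric_iff (f : ℝ → ℝ) (hf : AnalyticOnNhd ℝ f Set.univ) :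
    (planeWave f hf).IsLocallySymmetric ↔ ∀ y, deriv (deriv (deriv f)) y = 0 := by
  constructor
  · intro h y
    simpa [planeWave_nablaCurvature, waveCurvature] using h 0 1 1 0 1 (fun _ => y)
  · intro h i j k l m p
    simp [planeWave_nablaCurvature, h]

end Curvature

/-! ### Explicit isometries -/

noncomputable section Isometries

/-- The polynomial map `ℝ⁴ → ℝ⁴` which sends `P` to `Q`, scales `∂ₓ` by `α` and `∂_y` by `σ`, and
whose remaining coefficients compensate the affine change `h₀ + h₁ (y - P_y)` of the profile. -/
def waveMap (P Q : Fin 4 → ℝ) (α σ h₀ h₁ : ℝ) (p : Fin 4 → ℝ) : Fin 4 → ℝ :=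
  ![α * (p 0 - P 0) + Q 0,
    σ * (p 1 - P 1) + Q 1,
    (p 2 - P 2 + h₁ * (p 0 - P 0) * (p 1 - P 1) + h₀ * (p 0 - P 0)) * α⁻¹ + Q 2,
    σ * (p 3 - P 3 - h₁ * (p 0 - P 0) ^ 2 * 2⁻¹) + Q 3]

/-- The inverse of `waveMap P Q α σ h₀ h₁` when `α ≠ 0` and `σ ^ 2 = 1`. -/
def waveMapInv (P Q : Fin 4 → ℝ) (α σ h₀ h₁ : ℝ) (q : Fin 4 → ℝ) : Fin 4 → ℝ :=
  ![α⁻¹ * (q 0 - Q 0) + P 0,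
    σ * (q 1 - Q 1) + P 1,
    α * (q 2 - Q 2) - h₁ * (α⁻¹ * (q 0 - Q 0)) * (σ * (q 1 - Q 1))
      - h₀ * (α⁻¹ * (q 0 - Q 0)) + P 2,
    σ * (q 3 - Q 3) + h₁ * (α⁻¹ * (q 0 - Q 0)) ^ 2 * 2⁻¹ + P 3]

/-- `waveMap` as a permutation of `ℝ⁴`. -/
def waveEquiv (P Q : Fin 4 → ℝ) {α σ : ℝ} (hα : α ≠ 0) (hσ : σ ^ 2 = 1) (h₀ h₁ : ℝ) :
    Equiv.Perm (Fin 4 → ℝ) where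
  toFun := waveMap P Q α σ h₀ h₁
  invFun := waveMapInv P Q α σ h₀ h₁
  left_inv p := by
    have hα' : α⁻¹ * α = 1 := inv_mul_cancel₀ hα
    ext i
    fin_cases i <;> simp [waveMap, waveMapInv]
    · linear_combination (p 0 - P 0) * hα'
    · linear_combination (p 1 - P 1) * hσ
    · field_simp
      linear_combination -(h₁ * (p 0 - P 0) * (p 1 - P 1)) * hσ
    · field_simp
      linear_combination (2 * (p 3 - P 3) - h₁ * (p 0 - P 0) ^ 2) * hσ
  right_inv q := by
    have hα' : α⁻¹ * α = 1 := inv_mul_cancel₀ hα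
    ext i
    fin_cases i <;> simp [waveMap, waveMapInv]
    · field_simp
      ring
    · linear_combination (q 1 - Q 1) * hσ
    · field_simp
      ring
    · field_simp
      linear_combination (q 3 - Q 3) * hσ

theorem waveMap_apply_base (P Q : Fin 4 → ℝ) (α σ h₀ h₁ : ℝ) : waveMap P Q α σ h₀ h₁ P = Q := by
  ext i
  fin_cases i <;> simp [waveMap]

theorem contDiff_waveMap (P Q : Fin 4 → ℝ) (α σ h₀ h₁ : ℝ) :
    ContDiff ℝ ∞ (waveMap P Q α σ h₀ h₁) := by
  rw [contDiff_pi]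
  intro i
  fin_cases i <;> simp [waveMap] <;> fun_prop

theorem contDiff_waveMapInv (P Q : Fin 4 → ℝ) (α σ h₀ h₁ : ℝ) :
    ContDiff ℝ ∞ (waveMapInv P Q α σ h₀ h₁) := by
  rw [contDiff_pi]
  intro i
  fin_cases i <;> simp [waveMapInv] <;> fun_prop

theorem hasDerivAt_zero_of_eq_quadratic {F : ℝ → ℝ} (a b c : ℝ)
    (hF : ∀ t, F t = a + b * t + c * t ^ 2) : HasDerivAt F b 0 := by
  have h := (((hasDerivAt_id (0 : ℝ)).const_mul b).const_add a).add
    (((hasDerivAt_id (0 : ℝ)).pow 2).const_mul c)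
  refine (h.congr_of_eventuallyEq (.of_forall fun t => ?_)).congr_deriv (by simp)
  simp [hF]

theorem fderiv_waveMap (P Q : Fin 4 → ℝ) (α σ h₀ h₁ : ℝ) (p u : Fin 4 → ℝ) :
    fderiv ℝ (waveMap P Q α σ h₀ h₁) p u =
      ![α * u 0, σ * u 1,
        (u 2 + h₁ * (u 0 * (p 1 - P 1) + (p 0 - P 0) * u 1) + h₀ * u 0) * α⁻¹,
        σ * (u 3 - h₁ * (p 0 - P 0) * u 0)] := by
  -- Along a line `p + t u` each component is a polynomial in `t` of degree at most two, so its
  -- linear coefficient is the derivative.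
  rw [← ((contDiff_waveMap P Q α σ h₀ h₁).differentiable (by simp) p).lineDeriv_eq_fderiv]
  apply HasLineDerivAt.lineDeriv
  rw [HasLineDerivAt, hasDerivAt_pi]
  intro i
  fin_cases i
  · refine hasDerivAt_zero_of_eq_quadratic (α * (p 0 - P 0) + Q 0) (α * u 0) 0 fun t => ?_
    simp [waveMap]
    ring
  · refine hasDerivAt_zero_of_eq_quadratic (σ * (p 1 - P 1) + Q 1) (σ * u 1) 0 fun t => ?_
    simp [waveMap]
    ring
  · refine hasDerivAt_zero_of_eq_quadratic
      ((p 2 - P 2 + h₁ * (p 0 - P 0) * (p 1 - P 1) + h₀ * (p 0 - P 0)) * α⁻¹ + Q 2)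
      ((u 2 + h₁ * (u 0 * (p 1 - P 1) + (p 0 - P 0) * u 1) + h₀ * u 0) * α⁻¹)
      (h₁ * u 0 * u 1 * α⁻¹) fun t => ?_
    simp [waveMap]
    ring
  · refine hasDerivAt_zero_of_eq_quadratic (σ * (p 3 - P 3 - h₁ * (p 0 - P 0) ^ 2 * 2⁻¹) + Q 3)
      (σ * (u 3 - h₁ * (p 0 - P 0) * u 0)) (-(σ * h₁ * u 0 ^ 2 * 2⁻¹)) fun t => ?_
    simp [waveMap]
    ring

theorem planeWave_inner (f : ℝ → ℝ) (hf : AnalyticOnNhd ℝ f Set.univ) (p u v : Fin 4 → ℝ) :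
    (planeWave f hf).inner p u v =
      -2 * f (p 1) * u 0 * v 0 + u 0 * v 2 + u 2 * v 0 + u 1 * v 3 + u 3 * v 1 := by
  simp [PseudoRiemannianMetric.inner, planeWave, Fin.sum_univ_four]
  ring

/-- In the pullback, the product of the new `dx` and `dx̃` contributes `(h₀ + h₁ (y - P₁)) dx²`,
which offsets the change of profile. The cross term `h₁ (x - P₀) dx dy` it also produces is
cancelled by the quadratic correction in `ỹ`, as `σ² = 1`. -/
theorem waveEquiv_mem_isometryGroup (f : ℝ → ℝ) (hf : AnalyticOnNhd ℝ f Set.univ)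
    (P Q : Fin 4 → ℝ) {α σ : ℝ} (hα : α ≠ 0) (hσ : σ ^ 2 = 1) {h₀ h₁ : ℝ}
    (h : ∀ y, α ^ 2 * f (σ * (y - P 1) + Q 1) - f y = h₀ + h₁ * (y - P 1)) :
    waveEquiv P Q hα hσ h₀ h₁ ∈ (planeWave f hf).isometryGroup := by
  refine ⟨contDiff_waveMap P Q α σ h₀ h₁, contDiff_waveMapInv P Q α σ h₀ h₁, fun p u v => ?_⟩
  change (planeWave f hf).inner (waveMap P Q α σ h₀ h₁ p)
    (fderiv ℝ (waveMap P Q α σ h₀ h₁) p u) (fderiv ℝ (waveMap P Q α σ h₀ h₁) p v) = _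
  rw [fderiv_waveMap, fderiv_waveMap, planeWave_inner, planeWave_inner]
  simp only [waveMap, Matrix.cons_val]
  field_simp
  linear_combination (-2 * u 0 * v 0) * h (p 1) + (u 1 * v 3 + u 3 * v 1 -
    h₁ * (p 0 - P 0) * (u 1 * v 0 + u 0 * v 1)) * hσ

theorem planeWave_isHomogeneous_of_deriv_eq_exp (f : ℝ → ℝ) (hf : AnalyticOnNhd ℝ f Set.univ)
    {a lam : ℝ} (h : ∀ y, deriv (deriv f) y = a * Real.exp (lam * y)) :
    (planeWave f hf).IsHomogeneous := by
  intro P Q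
  have hfs : ContDiff ℝ ∞ f := hf.contDiff
  -- Chosen so that `α² f''(y + Q₁ - P₁) = f''(y)`; the difference of profiles then has zero second
  -- derivative and is affine.
  set α : ℝ := Real.exp (-(lam * (Q 1 - P 1)) / 2) with hα
  have hα0 : α ≠ 0 := (Real.exp_pos _).ne'
  have hα2 : α ^ 2 = Real.exp (-(lam * (Q 1 - P 1))) := by
    rw [hα, ← Real.exp_nat_mul]
    congr 1
    push_cast
    ring
  have hd : Differentiable ℝ f := hfs.differentiable (by simp)
  have hd' : Differentiable ℝ (deriv f) := (contDiff_deriv hfs).differentiable (by simp)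
  have e1 : deriv (fun y => α ^ 2 * f (y - P 1 + Q 1) - f y) =
      fun y => α ^ 2 * deriv f (y - P 1 + Q 1) - deriv f y := by
    funext y
    have h1 : HasDerivAt (fun y => y - P 1 + Q 1) 1 y :=
      ((hasDerivAt_id y).sub_const _).add_const _
    have h2 := (((hd _).hasDerivAt.comp y h1).const_mul (α ^ 2)).sub (hd y).hasDerivAt
    rw [mul_one] at h2
    exact h2.deriv
  have e2 : ∀ y, deriv (fun y => α ^ 2 * deriv f (y - P 1 + Q 1) - deriv f y) y = 0 := by
    intro y
    have h1 : HasDerivAt (fun y => y - P 1 + Q 1) 1 y :=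
      ((hasDerivAt_id y).sub_const _).add_const _
    have h2 := (((hd' _).hasDerivAt.comp y h1).const_mul (α ^ 2)).sub (hd' y).hasDerivAt
    refine h2.deriv.trans ?_
    rw [mul_one, h, h, hα2, mul_left_comm, ← Real.exp_add,
      show -(lam * (Q 1 - P 1)) + lam * (y - P 1 + Q 1) = lam * y by ring, sub_self]
  have key := eq_affine_of_deriv_deriv_eq_zero (h := fun y => α ^ 2 * f (y - P 1 + Q 1) - f y)
    (by fun_prop) (by rw [e1]; exact e2) (P 1)
  exact ⟨_, waveEquiv_mem_isometryGroup f hf P Q hα0 (one_pow 2) (by simpa using key),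
    waveMap_apply_base P Q α 1 _ _⟩

theorem planeWave_isSymmetricSpace_of_deriv_eq_zero (f : ℝ → ℝ)
    (hf : AnalyticOnNhd ℝ f Set.univ) (h : ∀ y, deriv (deriv (deriv f)) y = 0) :
    (planeWave f hf).IsSymmetricSpace := by
  intro P
  have hfs : ContDiff ℝ ∞ f := hf.contDiff
  have hd : Differentiable ℝ f := hfs.differentiable (by simp)
  have hd' : Differentiable ℝ (deriv f) := (contDiff_deriv hfs).differentiable (by simp)
  have hd2 : Differentiable ℝ (deriv (deriv f)) :=
    (contDiff_deriv (contDiff_deriv hfs)).differentiable (by simp)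
  have e1 : deriv (fun y => f (-(y - P 1) + P 1) - f y) =
      fun y => -deriv f (-(y - P 1) + P 1) - deriv f y := by
    funext y
    have h1 : HasDerivAt (fun y => -(y - P 1) + P 1) (-1) y :=
      ((hasDerivAt_id y).sub_const _).neg.add_const _
    have h2 := ((hd _).hasDerivAt.comp y h1).sub (hd y).hasDerivAt
    rw [mul_neg_one] at h2
    exact h2.deriv
  have e2 : ∀ y, deriv (fun y => -deriv f (-(y - P 1) + P 1) - deriv f y) y = 0 := by
    intro y
    have h1 : HasDerivAt (fun y => -(y - P 1) + P 1) (-1) y :=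
      ((hasDerivAt_id y).sub_const _).neg.add_const _
    have h2 := ((hd' _).hasDerivAt.comp y h1).neg.sub (hd' y).hasDerivAt
    rw [mul_neg_one, neg_neg, is_const_of_deriv_eq_zero hd2 h _ y, sub_self] at h2
    exact h2.deriv
  have key := eq_affine_of_deriv_deriv_eq_zero (h := fun y => f (-(y - P 1) + P 1) - f y)
    (by fun_prop) (by rw [e1]; exact e2) (P 1)
  simp only [sub_self, neg_zero, zero_add] at key
  -- The difference of profiles vanishes at `P₁`, so `h₀ = 0`; the `h₁` terms have zero differential
  -- at `P`, which leaves `-Id` there.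
  refine ⟨_, waveEquiv_mem_isometryGroup f hf P P (α := -1) (σ := -1) (by norm_num) (by norm_num)
    (h₀ := 0) (by simpa using key), waveMap_apply_base P P _ _ _ _, fun u => ?_⟩
  refine (fderiv_waveMap P P _ _ _ _ P u).trans ?_
  ext i
  fin_cases i <;> simp [inv_neg]

end Isometries

/-! ### Rigidity of isometries -/

section Rigidity

/-- The smooth functions `X, Y, Z, W` on `ℝ⁴` are the components of a local isometry of the plane
wave with profile `f`; `exists_preimage` says that the differential is surjective. -/
structure IsWaveIsometry (f : ℝ → ℝ) (X Y Z W : (Fin 4 → ℝ) → ℝ) : Prop where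
  smooth_f : ContDiff ℝ ∞ f
  smooth_X : ContDiff ℝ ∞ X
  smooth_Y : ContDiff ℝ ∞ Y
  smooth_Z : ContDiff ℝ ∞ Z
  smooth_W : ContDiff ℝ ∞ W
  metric_eq : ∀ i j p, -2 * (f (Y p) * (partialD i X p * partialD j X p)) +
    (partialD i X p * partialD j Z p + partialD i Z p * partialD j X p) +
    (partialD i Y p * partialD j W p + partialD i W p * partialD j Y p) =
    (if i = 0 ∧ j = 0 then -2 else 0) * f (p 1) +
      if (i = 0 ∧ j = 2) ∨ (i = 2 ∧ j = 0) ∨ (i = 1 ∧ j = 3) ∨ (i = 3 ∧ j = 1) then 1 else 0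
  exists_preimage : ∀ p (v : Fin 4 → ℝ), ∃ c : Fin 4 → ℝ,
    ∑ l, c l * partialD l X p = v 0 ∧ ∑ l, c l * partialD l Y p = v 1 ∧
    ∑ l, c l * partialD l Z p = v 2 ∧ ∑ l, c l * partialD l W p = v 3

theorem isWaveIsometry_of_mem_isometryGroup {f : ℝ → ℝ} {hf : AnalyticOnNhd ℝ f Set.univ}
    {φ : Equiv.Perm (Fin 4 → ℝ)} (hφ : φ ∈ (planeWave f hf).isometryGroup) :
    IsWaveIsometry f (fun p => φ p 0) (fun p => φ p 1) (fun p => φ p 2) (fun p => φ p 3) := by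
  have hφ1 := hφ
  obtain ⟨h1, h2, h3⟩ := hφ
  have hsm : ∀ a, ContDiff ℝ ∞ (fun p => φ p a) := fun a => contDiff_pi.1 h1 a
  have hcomp : ∀ a p u, fderiv ℝ φ p u a = fderiv ℝ (fun q => φ q a) p u := by
    intro a p u
    rw [fderiv_pi fun a => (hsm a).differentiable (by simp) p]
    rfl
  refine ⟨hf.contDiff, hsm 0, hsm 1, hsm 2, hsm 3, fun i j p => ?_, fun p v => ?_⟩
  · have h := h3 p (Pi.single i 1) (Pi.single j 1)
    rw [planeWave_inner] at h
    simp only [hcomp] at h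
    have hi : (planeWave f hf).inner p (Pi.single i 1) (Pi.single j 1) =
        (planeWave f hf).g p i j := by
      simp [PseudoRiemannianMetric.inner, Pi.single_apply]
    rw [hi, planeWave_g_apply] at h
    rw [← h]
    simp only [partialD]
    ring
  · have h : (fderiv ℝ φ p).comp (fderiv ℝ φ.symm (φ p)) = ContinuousLinearMap.id ℝ _ := by
      have h4 : HasFDerivAt φ (fderiv ℝ φ p) (φ.symm (φ p)) := by
        rw [Equiv.symm_apply_apply]
        exact (h1.differentiable (by simp) _).hasFDerivAt
      have h5 := h4.comp (φ p) (h2.differentiable (by simp) (φ p)).hasFDerivAt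
      have h6 : ⇑φ ∘ ⇑φ.symm = id := by ext x : 1; simp
      rw [h6] at h5
      exact h5.unique (hasFDerivAt_id _)
    have hv : ∀ a, ∑ l, fderiv ℝ φ.symm (φ p) v l * partialD l (fun q => φ q a) p = v a := by
      intro a
      rw [← fderiv_apply_eq_sum_partialD, ← hcomp]
      exact congrArg (fun L : (Fin 4 → ℝ) →L[ℝ] (Fin 4 → ℝ) => L v a) h
    exact ⟨_, hv 0, hv 1, hv 2, hv 3⟩

namespace IsWaveIsometry

variable {f : ℝ → ℝ} {X Y Z W : (Fin 4 → ℝ) → ℝ}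

theorem partialD_metric_eq (h : IsWaveIsometry f X Y Z W) (l i j : Fin 4) (p : Fin 4 → ℝ) :
    -2 * (deriv f (Y p) * partialD l Y p * (partialD i X p * partialD j X p) +
      f (Y p) * (partialD i X p * partialD l (partialD j X) p +
        partialD l (partialD i X) p * partialD j X p)) +
    (partialD i X p * partialD l (partialD j Z) p + partialD l (partialD i X) p * partialD j Z p +
      (partialD i Z p * partialD l (partialD j X) p +
        partialD l (partialD i Z) p * partialD j X p)) +
    (partialD i Y p * partialD l (partialD j W) p + partialD l (partialD i Y) p * partialD j W p +
      (partialD i W p * partialD l (partialD j Y) p +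
        partialD l (partialD i W) p * partialD j Y p)) =
    if i = 0 ∧ j = 0 ∧ l = 1 then -2 * deriv f (p 1) else 0 := by
  have dif : Differentiable ℝ f := h.smooth_f.differentiable (by simp)
  have diY : Differentiable ℝ Y := h.smooth_Y.differentiable (by simp)
  have dX : ∀ i, Differentiable ℝ (partialD i X) := fun i =>
    (contDiff_partialD h.smooth_X i).differentiable (by simp)
  have dY : ∀ i, Differentiable ℝ (partialD i Y) := fun i =>
    (contDiff_partialD h.smooth_Y i).differentiable (by simp)
  have dZ : ∀ i, Differentiable ℝ (partialD i Z) := fun i =>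
    (contDiff_partialD h.smooth_Z i).differentiable (by simp)
  have dW : ∀ i, Differentiable ℝ (partialD i W) := fun i =>
    (contDiff_partialD h.smooth_W i).differentiable (by simp)
  have e := congrArg (fun F => partialD l F p) (funext (h.metric_eq i j))
  rw [partialD_add (by fun_prop) (by fun_prop), partialD_add (by fun_prop) (by fun_prop),
    partialD_const_mul _ (by fun_prop), partialD_mul (by fun_prop) (by fun_prop),
    partialD_comp dif diY, partialD_mul (dX i) (dX j),
    partialD_add (by fun_prop) (by fun_prop), partialD_mul (dX i) (dZ j),
    partialD_mul (dZ i) (dX j), partialD_add (by fun_prop) (by fun_prop),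
    partialD_mul (dY i) (dW j), partialD_mul (dW i) (dY j),
    partialD_add (by fun_prop) (by fun_prop), partialD_const_mul _ (by fun_prop),
    partialD_comp_coord dif, partialD_const] at e
  have hr : (if i = 0 ∧ j = 0 then (-2 : ℝ) else 0) * (if l = 1 then deriv f (p 1) else 0) + 0 =
      if i = 0 ∧ j = 0 ∧ l = 1 then -2 * deriv f (p 1) else 0 := by
    split_ifs <;> simp_all
  rw [hr] at e
  linear_combination e

/-- The Koszul combination of the three differentiated metric equations: all second derivatives
cancel except those in `i, j`. It expresses that an isometry intertwines the Levi-Civita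
connections. -/
theorem koszul (h : IsWaveIsometry f X Y Z W) (i j l : Fin 4) (p : Fin 4 → ℝ) :
    2 * (-2 * (f (Y p) * (partialD i (partialD j X) p * partialD l X p)) +
      (partialD i (partialD j X) p * partialD l Z p +
        partialD i (partialD j Z) p * partialD l X p) +
      (partialD i (partialD j Y) p * partialD l W p +
        partialD i (partialD j W) p * partialD l Y p)) -
      2 * deriv f (Y p) * (partialD i Y p * partialD j X p * partialD l X p +
        partialD j Y p * partialD i X p * partialD l X p -
        partialD l Y p * partialD i X p * partialD j X p) =
    (if j = 0 ∧ l = 0 ∧ i = 1 then -2 * deriv f (p 1) else 0) +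
      (if i = 0 ∧ l = 0 ∧ j = 1 then -2 * deriv f (p 1) else 0) -
      (if i = 0 ∧ j = 0 ∧ l = 1 then -2 * deriv f (p 1) else 0) := by
  have e1 := h.partialD_metric_eq i j l p
  have e2 := h.partialD_metric_eq j i l p
  have e3 := h.partialD_metric_eq l i j p
  rw [partialD_comm h.smooth_X j i, partialD_comm h.smooth_Y j i, partialD_comm h.smooth_Z j i,
    partialD_comm h.smooth_W j i] at e2
  rw [partialD_comm h.smooth_X l i, partialD_comm h.smooth_Y l i, partialD_comm h.smooth_Z l i,
    partialD_comm h.smooth_W l i, partialD_comm h.smooth_X l j, partialD_comm h.smooth_Y l j,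
    partialD_comm h.smooth_Z l j, partialD_comm h.smooth_W l j] at e3
  linear_combination e1 + e2 - e3

/-- Lowering of an index: with `t = f(y)`, both sides are `g(∂ₖ, c)`. -/
theorem sum_metric (c : Fin 4 → ℝ) (k : Fin 4) (t : ℝ) :
    ∑ l, c l * ((if k = 0 ∧ l = 0 then -2 else 0) * t +
      if (k = 0 ∧ l = 2) ∨ (k = 2 ∧ l = 0) ∨ (k = 1 ∧ l = 3) ∨ (k = 3 ∧ l = 1) then 1 else 0) =
    ![-2 * t * c 0 + c 2, c 3, c 0, c 1] k := by
  fin_cases k <;> simp [Fin.sum_univ_four]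
  ring

/-- As `dx = g(∂_x̃, ·)` is parallel, so is its pullback `dX`. The vector `c` which the differential
sends to `∂_x̃` is the gradient of `X`; pairing the Koszul identity with `c` isolates the Hessian of
`X`. -/
theorem partialD_partialD_X (h : IsWaveIsometry f X Y Z W) (i j : Fin 4) (p : Fin 4 → ℝ) :
    partialD i (partialD j X) p = (if i = 0 ∧ j = 0 then deriv f (p 1) * partialD 3 X p else 0) -
      if (i = 0 ∧ j = 1) ∨ (i = 1 ∧ j = 0) then deriv f (p 1) * partialD 2 X p else 0 := by
  obtain ⟨c, hX, hY, hZ, hW⟩ := h.exists_preimage p ![0, 0, 1, 0]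
  simp only [Fin.sum_univ_four, Matrix.cons_val] at hX hY hZ hW
  have hc : ∀ k, partialD k X p = ![-2 * f (p 1) * c 0 + c 2, c 3, c 0, c 1] k := by
    intro k
    rw [← sum_metric, Fin.sum_univ_four, ← h.metric_eq, ← h.metric_eq, ← h.metric_eq,
      ← h.metric_eq]
    linear_combination (2 * f (Y p) * partialD k X p - partialD k Z p) * hX -
      partialD k X p * hZ - partialD k Y p * hW - partialD k W p * hY
  have h0 : partialD 2 X p = c 0 := hc 2
  have h1 : partialD 3 X p = c 1 := hc 3
  have e : 2 * partialD i (partialD j X) p = ∑ l, c l *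
      ((if j = 0 ∧ l = 0 ∧ i = 1 then -2 * deriv f (p 1) else 0) +
      (if i = 0 ∧ l = 0 ∧ j = 1 then -2 * deriv f (p 1) else 0) -
      (if i = 0 ∧ j = 0 ∧ l = 1 then -2 * deriv f (p 1) else 0)) := by
    simp only [← h.koszul, Fin.sum_univ_four]
    linear_combination (4 * f (Y p) * partialD i (partialD j X) p -
        2 * partialD i (partialD j Z) p + 2 * deriv f (Y p) * (partialD i Y p * partialD j X p +
        partialD j Y p * partialD i X p)) * hX - 2 * partialD i (partialD j X) p * hZ -
      2 * partialD i (partialD j Y) p * hW - (2 * partialD i (partialD j W) p +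
        2 * deriv f (Y p) * partialD i X p * partialD j X p) * hY
  rw [h0, h1]
  refine mul_left_cancel₀ two_ne_zero (e.trans ?_)
  rw [Fin.sum_univ_four]
  fin_cases i <;> fin_cases j <;> simp <;> ring

theorem partialD_partialD_Y (h : IsWaveIsometry f X Y Z W) (i j : Fin 4) (p : Fin 4 → ℝ) :
    partialD i (partialD j Y) p = (if i = 0 ∧ j = 0 then deriv f (p 1) * partialD 3 Y p else 0) -
      if (i = 0 ∧ j = 1) ∨ (i = 1 ∧ j = 0) then deriv f (p 1) * partialD 2 Y p else 0 := by
  -- Since `dy = g(∂_ỹ, ·)`, the gradient of `Y` is the vector sent to `∂_ỹ`.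
  obtain ⟨c, hX, hY, hZ, hW⟩ := h.exists_preimage p ![0, 0, 0, 1]
  simp only [Fin.sum_univ_four, Matrix.cons_val] at hX hY hZ hW
  have hc : ∀ k, partialD k Y p = ![-2 * f (p 1) * c 0 + c 2, c 3, c 0, c 1] k := by
    intro k
    rw [← sum_metric, Fin.sum_univ_four, ← h.metric_eq, ← h.metric_eq, ← h.metric_eq,
      ← h.metric_eq]
    linear_combination (2 * f (Y p) * partialD k X p - partialD k Z p) * hX -
      partialD k X p * hZ - partialD k Y p * hW - partialD k W p * hY
  have h0 : partialD 2 Y p = c 0 := hc 2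
  have h1 : partialD 3 Y p = c 1 := hc 3
  have e : 2 * partialD i (partialD j Y) p = ∑ l, c l *
      ((if j = 0 ∧ l = 0 ∧ i = 1 then -2 * deriv f (p 1) else 0) +
      (if i = 0 ∧ l = 0 ∧ j = 1 then -2 * deriv f (p 1) else 0) -
      (if i = 0 ∧ j = 0 ∧ l = 1 then -2 * deriv f (p 1) else 0)) := by
    simp only [← h.koszul, Fin.sum_univ_four]
    linear_combination (4 * f (Y p) * partialD i (partialD j X) p -
        2 * partialD i (partialD j Z) p + 2 * deriv f (Y p) * (partialD i Y p * partialD j X p +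
        partialD j Y p * partialD i X p)) * hX - 2 * partialD i (partialD j X) p * hZ -
      2 * partialD i (partialD j Y) p * hW - (2 * partialD i (partialD j W) p +
        2 * deriv f (Y p) * partialD i X p * partialD j X p) * hY
  rw [h0, h1]
  refine mul_left_cancel₀ two_ne_zero (e.trans ?_)
  rw [Fin.sum_univ_four]
  fin_cases i <;> fin_cases j <;> simp <;> ring

end IsWaveIsometry

/-- A smooth function whose Hessian is `∇_{∂ᵢ} ∂ⱼ`, that is, with parallel differential, is affine
in `x, y` alone unless `f'' = 0`. -/
theorem partialD_eq_of_parallel {f : ℝ → ℝ} (hf : ContDiff ℝ ∞ f) {F : (Fin 4 → ℝ) → ℝ}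
    (hF : ContDiff ℝ ∞ F) (h : ∀ i j p, partialD i (partialD j F) p =
      (if i = 0 ∧ j = 0 then deriv f (p 1) * partialD 3 F p else 0) -
      if (i = 0 ∧ j = 1) ∨ (i = 1 ∧ j = 0) then deriv f (p 1) * partialD 2 F p else 0)
    {y₀ : ℝ} (hy₀ : deriv (deriv f) y₀ ≠ 0) :
    (∀ p, partialD 2 F p = 0) ∧ (∀ p, partialD 3 F p = 0) ∧
      ∀ i j p, partialD i (partialD j F) p = 0 := by
  have hd : Differentiable ℝ (deriv f) := (contDiff_deriv hf).differentiable (by simp)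
  have dF : ∀ i, Differentiable ℝ (partialD i F) := fun i =>
    (contDiff_partialD hF i).differentiable (by simp)
  set P : Fin 4 → ℝ := fun _ => y₀
  have c2 : ∀ p, partialD 2 F p = partialD 2 F P := fun p =>
    eq_const_of_partialD_eq_zero (dF 2) (fun i p => by simp [h]) p P
  have c3 : ∀ p, partialD 3 F p = partialD 3 F P := fun p =>
    eq_const_of_partialD_eq_zero (dF 3) (fun i p => by simp [h]) p P
  have h00 : partialD 0 (partialD 0 F) = fun p => partialD 3 F P * deriv f (p 1) := by
    funext p; simp [h, c3 p, mul_comm]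
  have h01 : partialD 0 (partialD 1 F) = fun p => -partialD 2 F P * deriv f (p 1) := by
    funext p; simp [h, c2 p, mul_comm]
  have h10 : partialD 1 (partialD 0 F) = fun p => -partialD 2 F P * deriv f (p 1) := by
    funext p; simp [h, c2 p, mul_comm]
  have h11 : partialD 1 (partialD 1 F) = fun p => 0 := by
    funext p; simp [h]
  -- The second derivatives depend on `y` alone, so commuting `∂ₓ` and `∂_y` on `∂ₓF` gives `f'' ∂₃F
  -- = 0`; on `∂_yF` it gives `f'' ∂₂F = 0` below.
  have z3 : partialD 3 F P = 0 := by
    have := partialD_comm (contDiff_partialD hF 0) 1 0 P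
    rw [h00, h10, partialD_const_mul _ (by fun_prop), partialD_const_mul _ (by fun_prop),
      partialD_comp_coord hd, partialD_comp_coord hd] at this
    simpa [P, hy₀] using this
  have z2 : partialD 2 F P = 0 := by
    have := partialD_comm (contDiff_partialD hF 1) 1 0 P
    rw [h01, h11, partialD_const_mul _ (by fun_prop), partialD_comp_coord hd] at this
    simpa [P, hy₀] using this
  refine ⟨fun p => (c2 p).trans z2, fun p => (c3 p).trans z3, fun i j p => ?_⟩
  simp [h, c2 p, c3 p, z2, z3]

namespace IsWaveIsometry

variable {f : ℝ → ℝ} {X Y Z W : (Fin 4 → ℝ) → ℝ}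

theorem deriv_deriv_comp_affine {h : ℝ → ℝ} (hh : ContDiff ℝ ∞ h) {Y : (Fin 4 → ℝ) → ℝ}
    (hY : ContDiff ℝ ∞ Y) {i j : Fin 4} {s t : ℝ} (hi : ∀ p, partialD i Y p = s)
    (hj : ∀ p, partialD j Y p = t) (p : Fin 4 → ℝ) :
    partialD i (partialD j (fun q => h (Y q))) p = s * t * deriv (deriv h) (Y p) := by
  have hd : Differentiable ℝ h := hh.differentiable (by simp)
  have hd' : Differentiable ℝ (deriv h) := (contDiff_deriv hh).differentiable (by simp)
  have dY : Differentiable ℝ Y := hY.differentiable (by simp)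
  have e : partialD j (fun q => h (Y q)) = fun q => t * deriv h (Y q) := by
    funext q
    rw [partialD_comp hd dY, hj, mul_comm]
  rw [e, partialD_const_mul _ (by fun_prop), partialD_comp hd' dY, hi]
  ring

/-- In the non-flat case an isometry acts on `x, y` by an affine map, and it rescales `f''` by the
square of the determinant of that map. -/
theorem rigidity (h : IsWaveIsometry f X Y Z W) {y₀ : ℝ} (hy₀ : deriv (deriv f) y₀ ≠ 0)
    (P : Fin 4 → ℝ) :
    ∃ c, (∀ p, Y p = partialD 0 Y P * p 0 + partialD 1 Y P * p 1 + c) ∧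
      ∀ x y, deriv (deriv f) (partialD 0 Y P * x + partialD 1 Y P * y + c) *
        (partialD 0 X P * partialD 1 Y P - partialD 1 X P * partialD 0 Y P) ^ 2 =
          deriv (deriv f) y := by
  obtain ⟨X2, X3, XX⟩ := partialD_eq_of_parallel h.smooth_f h.smooth_X h.partialD_partialD_X hy₀
  obtain ⟨Y2, Y3, YY⟩ := partialD_eq_of_parallel h.smooth_f h.smooth_Y h.partialD_partialD_Y hy₀
  have cX : ∀ i p, partialD i X p = partialD i X P := fun i p =>
    eq_const_of_partialD_eq_zero ((contDiff_partialD h.smooth_X i).differentiable (by simp))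
      (fun j q => XX j i q) p P
  have cY : ∀ i p, partialD i Y p = partialD i Y P := fun i p =>
    eq_const_of_partialD_eq_zero ((contDiff_partialD h.smooth_Y i).differentiable (by simp))
      (fun j q => YY j i q) p P
  have hYp : ∀ p, Y p = partialD 0 Y P * p 0 + partialD 1 Y P * p 1 +
      (Y P - partialD 0 Y P * P 0 - partialD 1 Y P * P 1) := by
    intro p
    rw [eq_affine_of_partialD_partialD_eq_zero h.smooth_Y YY P p, Fin.sum_univ_four, Y2, Y3]
    ring
  refine ⟨_, hYp, fun x y => ?_⟩
  set α := partialD 0 X P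
  set ρ := partialD 1 X P
  set τ := partialD 0 Y P
  set σ := partialD 1 Y P
  have hf := h.smooth_f
  have hY := h.smooth_Y
  have hZ := h.smooth_Z
  have hW := h.smooth_W
  have dZ : Differentiable ℝ Z := hZ.differentiable (by simp)
  have dW : Differentiable ℝ W := hW.differentiable (by simp)
  -- With constant `dX` and `dY`, the metric equations on the `(x, y)` plane prescribe `∂₀A`, `∂₁B`
  -- and `∂₁A + ∂₀B`, a strain-type system.
  set A : (Fin 4 → ℝ) → ℝ := fun p => α * Z p + τ * W p with hA
  set B : (Fin 4 → ℝ) → ℝ := fun p => ρ * Z p + σ * W p with hB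
  have sA : ContDiff ℝ ∞ A := by fun_prop
  have sB : ContDiff ℝ ∞ B := by fun_prop
  have dA : ∀ i p, partialD i A p = α * partialD i Z p + τ * partialD i W p := by
    intro i p
    rw [hA, partialD_add (by fun_prop) (by fun_prop), partialD_const_mul _ dZ,
      partialD_const_mul _ dW]
  have dB : ∀ i p, partialD i B p = ρ * partialD i Z p + σ * partialD i W p := by
    intro i p
    rw [hB, partialD_add (by fun_prop) (by fun_prop), partialD_const_mul _ dZ,
      partialD_const_mul _ dW]
  have A0 : partialD 0 A = fun p => α ^ 2 * f (Y p) - f (p 1) := by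
    funext p
    have := h.metric_eq 0 0 p
    rw [cX 0, cY 0] at this
    rw [dA]
    simp at this
    linear_combination this / 2
  have B1 : partialD 1 B = fun p => ρ ^ 2 * f (Y p) := by
    funext p
    have := h.metric_eq 1 1 p
    rw [cX 1, cY 1] at this
    rw [dB]
    simp at this
    linear_combination this / 2
  have A1 : ∀ p, partialD 1 A p = 2 * α * ρ * f (Y p) - partialD 0 B p := by
    intro p
    have := h.metric_eq 0 1 p
    rw [cX 0, cY 0, cX 1, cY 1] at this
    rw [dA, dB]
    simp at this
    linear_combination this
  have sfY : ContDiff ℝ ∞ (fun q => f (Y q)) := hf.comp hY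
  have sf1 : ContDiff ℝ ∞ (fun q : Fin 4 → ℝ => f (q 1)) := hf.comp (contDiff_apply ..)
  have dif : ∀ {F : (Fin 4 → ℝ) → ℝ}, ContDiff ℝ ∞ F → Differentiable ℝ F := fun hF =>
    hF.differentiable (by simp)
  set p : Fin 4 → ℝ := ![x, y, 0, 0] with hp
  have hess : ∀ i j, partialD i (partialD j (fun q => f (Y q))) p =
      partialD i Y P * partialD j Y P * deriv (deriv f) (Y p) := fun i j =>
    deriv_deriv_comp_affine hf hY (cY i) (cY j) p
  have hess1 : partialD 1 (partialD 1 (fun q : Fin 4 → ℝ => f (q 1))) p = deriv (deriv f) y := by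
    rw [deriv_deriv_comp_affine (s := 1) (t := 1) hf (contDiff_apply ..)
      (fun q => by rw [partialD_coord]; simp) (fun q => by rw [partialD_coord]; simp)]
    simp [hp]
  have e1 : partialD 1 (partialD 1 (partialD 0 A)) p =
      α ^ 2 * partialD 1 (partialD 1 (fun q => f (Y q))) p - deriv (deriv f) y := by
    have : partialD 1 (partialD 0 A) = fun q => α ^ 2 * partialD 1 (fun q => f (Y q)) q -
        partialD 1 (fun q : Fin 4 → ℝ => f (q 1)) q := by
      funext q
      rw [A0, partialD_sub ((dif sfY).const_mul _) (dif sf1), partialD_const_mul _ (dif sfY)]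
    rw [this, partialD_sub ((dif (contDiff_partialD sfY 1)).const_mul _)
      (dif (contDiff_partialD sf1 1)), partialD_const_mul _ (dif (contDiff_partialD sfY 1)), hess1]
  have e2 : partialD 0 (partialD 0 (partialD 1 B)) p =
      ρ ^ 2 * partialD 0 (partialD 0 (fun q => f (Y q))) p := by
    have : partialD 0 (partialD 1 B) = fun q => ρ ^ 2 * partialD 0 (fun q => f (Y q)) q := by
      funext q
      rw [B1, partialD_const_mul _ (dif sfY)]
    rw [this, partialD_const_mul _ (dif (contDiff_partialD sfY 0))]
  have e3 : partialD 0 (partialD 1 (partialD 1 A)) p =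
      2 * α * ρ * partialD 0 (partialD 1 (fun q => f (Y q))) p -
        partialD 0 (partialD 1 (partialD 0 B)) p := by
    have : partialD 1 (partialD 1 A) = fun q => 2 * α * ρ * partialD 1 (fun q => f (Y q)) q -
        partialD 1 (partialD 0 B) q := by
      funext q
      rw [funext A1, partialD_sub ((dif sfY).const_mul _) (dif (contDiff_partialD sB 0)),
        partialD_const_mul _ (dif sfY)]
    rw [this, partialD_sub ((dif (contDiff_partialD sfY 1)).const_mul _)
      (dif (contDiff_partialD (contDiff_partialD sB 0) 1)),
      partialD_const_mul _ (dif (contDiff_partialD sfY 1))]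
  -- The compatibility condition `∂₁²∂₀A + ∂₀²∂₁B = ∂₀∂₁(∂₁A + ∂₀B)` gives `(α²σ² + ρ²τ² - 2αρτσ)
  -- f''(Y) = f''(y)`.
  have s1 : partialD 1 (partialD 1 (partialD 0 A)) p = partialD 0 (partialD 1 (partialD 1 A)) p := by
    rw [funext (partialD_comm sA 1 0), partialD_comm (contDiff_partialD sA 1) 1 0]
  have s2 : partialD 0 (partialD 0 (partialD 1 B)) p = partialD 0 (partialD 1 (partialD 0 B)) p := by
    rw [funext (partialD_comm sB 0 1)]
  rw [hess] at e1 e2 e3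
  have hval : Y p = τ * x + σ * y + (Y P - τ * P 0 - σ * P 1) := hYp p
  rw [← hval]
  linear_combination s1 + s2 - e1 - e2 + e3

end IsWaveIsometry

end Rigidity

/-! ### From isometries to the form of the profile -/

section Main

/-- A differentiable function with constant logarithmic derivative is an exponential. -/
theorem eq_mul_exp_of_deriv_eq {u : ℝ → ℝ} (hu : Differentiable ℝ u) {lam : ℝ}
    (h : ∀ y, deriv u y = lam * u y) (y : ℝ) : u y = u 0 * Real.exp (lam * y) := by
  have hc := is_const_of_deriv_eq_zero (f := fun z => u z * Real.exp (-(lam * z)))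
    (by fun_prop) (fun z => ?_) y 0
  · simp only [mul_zero, neg_zero, Real.exp_zero, mul_one] at hc
    rw [← hc, mul_assoc, ← Real.exp_add]
    simp
  · have h1 : HasDerivAt (fun z => Real.exp (-(lam * z))) (Real.exp (-(lam * z)) * -(lam * 1)) z :=
      (((hasDerivAt_id z).const_mul lam).neg).exp
    refine ((hu z).hasDerivAt.mul h1).deriv.trans ?_
    rw [h]
    ring

/-- A smooth function whose rescalings by affine maps with arbitrary translation part reproduce it
is an exponential. -/
theorem exists_eq_mul_exp_of_rescaling {u : ℝ → ℝ} (hu : ContDiff ℝ ∞ u) {y₀ : ℝ} (hy₀ : u y₀ ≠ 0)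
    (h : ∀ c, ∃ σ k : ℝ, ∀ y, u (σ * y + c) * k = u y) :
    ∃ a lam : ℝ, ∀ y, u y = a * Real.exp (lam * y) := by
  have du : Differentiable ℝ u := hu.differentiable (by simp)
  have hu' := contDiff_deriv hu
  choose σ k hk using h
  have k0 : ∀ c, k c ≠ 0 := by
    intro c hc
    apply hy₀
    rw [← hk c y₀, hc, mul_zero]
  have hc0 : ∀ c, u c * k c = u 0 := fun c => by simpa using hk c 0
  have u00 : u 0 ≠ 0 := by
    rw [← hc0 y₀]
    exact mul_ne_zero hy₀ (k0 _)
  have u0 : ∀ y, u y ≠ 0 := fun y hy => u00 (by rw [← hc0 y, hy, zero_mul])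
  have hlin : ∀ c y, HasDerivAt (fun y => σ c * y + c) (σ c) y := fun c y => by
    simpa using ((hasDerivAt_id y).const_mul (σ c)).add_const c
  have hk' : ∀ c y, deriv u (σ c * y + c) * σ c * k c = deriv u y := by
    intro c y
    have h1 := ((du _).hasDerivAt.comp y (hlin c y)).mul_const (k c)
    rw [← h1.deriv]
    congr 1
    exact funext (hk c)
  -- The logarithmic derivative eliminates the factor `k`: it satisfies `w(σy + c) σ = w(y)`.
  set w : ℝ → ℝ := fun y => deriv u y / u y with hw
  have sw : ContDiff ℝ ∞ w := hu'.div hu u0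
  have dw : Differentiable ℝ w := sw.differentiable (by simp)
  have hw1 : ∀ c y, w (σ c * y + c) * σ c = w y := by
    intro c y
    simp only [hw]
    rw [← hk' c y, ← hk c y]
    have := k0 c
    have := u0 (σ c * y + c)
    field_simp
  have hw2 : ∀ c y, deriv w (σ c * y + c) * σ c * σ c = deriv w y := by
    intro c y
    have h1 := ((dw _).hasDerivAt.comp y (hlin c y)).mul_const (σ c)
    rw [← h1.deriv]
    congr 1
    exact funext (hw1 c)
  have hw10 : ∀ c, w c * σ c = w 0 := fun c => by simpa using hw1 c 0
  have hw20 : ∀ c, deriv w c * σ c * σ c = deriv w 0 := fun c => by simpa using hw2 c 0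
  suffices hconst : ∀ y, w y = w 0 by
    refine ⟨u 0, w 0, eq_mul_exp_of_deriv_eq du fun y => ?_⟩
    rw [← hconst y, hw, div_mul_cancel₀ _ (u0 y)]
  by_cases hw0 : w 0 = 0
  · intro c
    rcases mul_eq_zero.1 ((hw10 c).trans hw0) with hc | hc
    · rw [hc, hw0]
    · rw [← hw1 c c, hc, mul_zero, hw0]
  · have σ0 : ∀ c, σ c ≠ 0 := fun c hc => hw0 (by rw [← hw10 c, hc, mul_zero])
    have w0 : ∀ c, w c ≠ 0 := fun c hc => hw0 (by rw [← hw10 c, hc, zero_mul])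
    -- The quotient `w' / w²` also eliminates `σ`, so it is constant.
    set K := deriv w 0 / w 0 ^ 2 with hK
    have hwK : ∀ c, deriv w c = K * w c ^ 2 := by
      intro c
      rw [hK, ← hw10 c, ← hw20 c]
      have := σ0 c
      have := w0 c
      field_simp
    have hv : ∀ y, (w y)⁻¹ + K * y = (w 0)⁻¹ := by
      intro y
      have := is_const_of_deriv_eq_zero (f := fun z => (w z)⁻¹ + K * z)
        ((dw.inv w0).add (by fun_prop)) (fun z => ?_) y 0
      · simpa using this
      · have h1 := ((dw z).hasDerivAt.inv (w0 z)).add ((hasDerivAt_id z).const_mul K)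
        refine h1.deriv.trans ?_
        rw [hwK]
        have := w0 z
        field_simp
        ring
    -- If `K ≠ 0`, the affine function `1/w` would vanish somewhere on the line.
    have hK0 : K = 0 := by
      by_contra hne
      have := hv ((w 0)⁻¹ / K)
      rw [mul_div_cancel₀ _ hne, add_eq_right] at this
      exact w0 _ (inv_eq_zero.1 this)
    intro y
    exact is_const_of_deriv_eq_zero dw (fun z => by rw [hwK, hK0, zero_mul]) y 0

theorem deriv_eq_zero_of_planeWave_isSymmetricSpace {f : ℝ → ℝ}
    {hf : AnalyticOnNhd ℝ f Set.univ} (h : (planeWave f hf).IsSymmetricSpace) (y : ℝ) :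
    deriv (deriv (deriv f)) y = 0 := by
  suffices hc : deriv (deriv f) = fun _ => deriv (deriv f) 0 by
    rw [hc]
    simp
  funext y
  by_cases hz : deriv (deriv f) y = 0 ∧ deriv (deriv f) 0 = 0
  · rw [hz.1, hz.2]
  obtain ⟨y₀, hy₀⟩ : ∃ y₀, deriv (deriv f) y₀ ≠ 0 := by
    by_contra! hne
    exact hz ⟨hne _, hne _⟩
  -- The reflection about a point with second coordinate `y / 2` exchanges the levels `y` and `0`,
  -- with determinant `1` on `(x, y)`.
  obtain ⟨φ, hφ, hP, hd⟩ := h ![0, y / 2, 0, 0]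
  have hφs : ContDiff ℝ ∞ φ := hφ.1
  obtain ⟨c, hc, hu⟩ := (isWaveIsometry_of_mem_isometryGroup hφ).rigidity hy₀ ![0, y / 2, 0, 0]
  have hD : ∀ i a, partialD i (fun p => φ p a) ![0, y / 2, 0, 0] =
      -(Pi.single i 1 : Fin 4 → ℝ) a := by
    intro i a
    have h1 := hd (Pi.single i 1)
    rw [fderiv_pi fun a => (contDiff_pi.1 hφs a).differentiable (by simp) _] at h1
    exact congrFun h1 a
  have h2 := hc ![0, y / 2, 0, 0]
  rw [hP] at h2
  have h3 := hu 0 y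
  simp [hD] at h2 h3
  rw [← h3]
  congr 1
  linarith

theorem exists_deriv_eq_exp_of_planeWave_isHomogeneous {f : ℝ → ℝ}
    {hf : AnalyticOnNhd ℝ f Set.univ} (h : (planeWave f hf).IsHomogeneous) :
    ∃ a lam : ℝ, ∀ y, deriv (deriv f) y = a * Real.exp (lam * y) := by
  by_cases hz : ∀ y, deriv (deriv f) y = 0
  · exact ⟨0, 0, by simpa using hz⟩
  push Not at hz
  obtain ⟨y₀, hy₀⟩ := hz
  have key : ∀ c, ∃ τ σ k : ℝ, ∀ x y, deriv (deriv f) (τ * x + σ * y + c) * k =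
      deriv (deriv f) y := by
    intro c
    -- The image of the origin is chosen to make the constant term of `Y` equal to `c`.
    obtain ⟨φ, hφ, hP⟩ := h 0 ![0, c, 0, 0]
    obtain ⟨c', hc, hu⟩ := (isWaveIsometry_of_mem_isometryGroup hφ).rigidity hy₀ 0
    have hc' := hc 0
    rw [hP] at hc'
    simp at hc'
    exact ⟨_, _, _, hc' ▸ hu⟩
  choose τ σ k hk using key
  by_cases hτ : ∃ c, τ c ≠ 0
  · obtain ⟨c, hc⟩ := hτ
    -- If `τ ≠ 0`, some `x` makes the argument of `f''` zero for any given `y`, so `f''` is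
    -- constant.
    refine ⟨deriv (deriv f) 0 * k c, 0, fun y => ?_⟩
    rw [← hk c (-(σ c * y + c) / τ c) y, mul_div_cancel₀ _ hc]
    simp
  · push Not at hτ
    exact exists_eq_mul_exp_of_rescaling (contDiff_deriv (contDiff_deriv hf.contDiff)) hy₀
      fun c => ⟨σ c, k c, fun y => by simpa [hτ c] using hk c 0 y⟩

end Main

theorem theorem1p4 (f : ℝ → ℝ) (hf : AnalyticOnNhd ℝ f Set.univ) :
    ((planeWave f hf).IsLocallySymmetric ↔ ∀ y : ℝ, iteratedDeriv 3 f y = 0) ∧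
    ((planeWave f hf).IsSymmetricSpace ↔ ∀ y : ℝ, iteratedDeriv 3 f y = 0) ∧
    ((planeWave f hf).IsHomogeneous ↔
      ∃ a lam : ℝ, ∀ y : ℝ, iteratedDeriv 2 f y = a * Real.exp (lam * y)) := by
  simp only [iteratedDeriv_succ, iteratedDeriv_zero]
  exact ⟨planeWave_isLocallySymmetric_iff f hf,
    ⟨deriv_eq_zero_of_planeWave_isSymmetricSpace,
      planeWave_isSymmetricSpace_of_deriv_eq_zero f hf⟩,
    ⟨exists_deriv_eq_exp_of_planeWave_isHomogeneous,
      fun ⟨_, _, h⟩ => planeWave_isHomogeneous_of_deriv_eq_exp f hf h⟩⟩
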